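/- **Setting.** Time is slotted, $t\in\{0,1,2,\dots\}$. On slot $t$ there are a renewable supply $s(t)$, an amount of newly arriving energy requests $a(t)$ and a market price $\gamma(t)$; these are random variables that satisfy, on every sample path and for all $t$, $0\le s(t)\le s_{\max}$, $0\le a(t)\le a_{\max}$, $0\le\gamma(t)\le\gamma_{\max}$ for finite constants. If $x(t)$ with $0\le x(t)\le x_{\max}$ is the energy allocated from the outside source on slot $t$, the backlog evolves by $$Q(t+1)=\max[Q(t)-s(t)-x(t),0]+a(t),$$ and the energy $s(t)+x(t)$ serves the waiting requests in first-in-first-out order (requests $a(t)$ can be served from slot $t+1$ on). For $\epsilon\ge0$ the virtual queue is $$Z(t+1)=\max[Z(t)-s(t)-x(t)+\epsilon 1_{\{Q(t)>0\}},0].$$ Given $V>0$, the threshold algorithm uses $x(t)=0$ if $Q(t)+Z(t)\le V\gamma(t)$ and $x(t)=x_{\max}$ otherwise. The amount it actually purchases is $\tilde x(t)=x(t)$ if $Q(t)-s(t)\ge x(t)$, and $\tilde x(t)=\max[Q(t)-s(t),0]$ otherwise. Let $c^*$ be the infimum of the time average cost $\liminf_{t\to\infty}\frac1t\sum_{\tau=0}^{t-1}\mathbb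 E[\gamma(\tau)x(\tau)]$ (the limit, when it exists) over all possible ways of choosing $x(t)$ over time, possibly randomized and with any information about the process $(s,a,\gamma)$, such that $0\le x(t)\le x_{\max}$ for all $t$ and, with $Q(0)=0$, $\limsup_{t\to\infty}\frac1t\sum_{\tau=0}^{t-1}\mathbb E[Q(\tau)]<\infty$. Let $$B=\frac{(s_{\max}+x_{\max})^2+a_{\max}^2}{2}+\frac{\max[\epsilon^2,(s_{\max}+x_{\max})^2]}{2}.$$ **Theorem.** Suppose $x_{\max}\ge\max[a_{\max},\epsilon]$, $Q(0)=Z(0)=0$, and the threshold algorithm is run on all slots with fixed $\epsilon\ge0$ and $V>0$. Then: (a) On every sample path and for every $t$, $Q(t)\le V\gamma_{\max}+a_{\max}$ and $Z(t)\le V\gamma_{\max}+\epsilon$. (b) If $\epsilon>0$, then on every sample path every request is served with a delay of at most $D_{\max}=\lceil(2V\gamma_{\max}+a_{\max}+\epsilon)/\epsilon\rceil$ slots: the requests arriving on slot $t$ are completely served by the end of slot $t+D_{\max}$. (c) If the vectors $(s(t),a(t),\gamma(t))$ are i.i.d. over slots and $\epsilon\le\max[\mathbb E[a(t)],\mathbb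 E[s(t)]]$, then for every $t>0$ $$\frac1t\sum_{\tau=0}^{t-1}\mathbb E[\gamma(\tau)\tilde x(\tau)]\le\frac1t\sum_{\tau=0}^{t-1}\mathbb E[\gamma(\tau)x(\tau)]\le c^*+\frac BV .$$ -/

import Mathlib

open MeasureTheory ProbabilityTheory Filter

noncomputable section

namespace RenewableEnergy

/-! ### Queue dynamics on a sample path -/

/-- One-slot update of the backlog: `max[q - s - x, 0] + a`. -/
def queueStep (q s x a : ℝ) : ℝ := max (q - s - x) 0 + a

/-- One-slot update of the virtual queue: `max[z - s - x + ε 1_{q > 0}, 0]`. -/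
def virtualStep (ε q z s x : ℝ) : ℝ := max (z - s - x + if 0 < q then ε else 0) 0

/-- Backlog `Q(t)` under an arbitrary decision sequence `x`, started empty. -/
def queue (s a x : ℕ → ℝ) : ℕ → ℝ
  | 0 => 0
  | t + 1 => queueStep (queue s a x t) (s t) (x t) (a t)

/-- The threshold rule: buy nothing if `q + z ≤ V g`, and `xmax` otherwise. -/
def threshold (V xmax g q z : ℝ) : ℝ := if q + z ≤ V * g then 0 else xmax

/-- The pair `(Q(t), Z(t))` under the threshold rule, started at `(0, 0)`. -/
def algState (V ε xmax : ℝ) (s a γ : ℕ → ℝ) : ℕ → ℝ × ℝ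
  | 0 => (0, 0)
  | t + 1 =>
    let q := (algState V ε xmax s a γ t).1
    let z := (algState V ε xmax s a γ t).2
    let x := threshold V xmax (γ t) q z
    (queueStep q (s t) x (a t), virtualStep ε q z (s t) x)

/-- The actual queue `Q(t)` of the threshold algorithm. -/
def algQ (V ε xmax : ℝ) (s a γ : ℕ → ℝ) (t : ℕ) : ℝ := (algState V ε xmax s a γ t).1

/-- The virtual queue `Z(t)` of the threshold algorithm. -/
def algZ (V ε xmax : ℝ) (s a γ : ℕ → ℝ) (t : ℕ) : ℝ := (algState V ε xmax s a γ t).2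

/-- The decision `x(t)` of the threshold algorithm. -/
def algX (V ε xmax : ℝ) (s a γ : ℕ → ℝ) (t : ℕ) : ℝ :=
  threshold V xmax (γ t) (algQ V ε xmax s a γ t) (algZ V ε xmax s a γ t)

/-- The amount actually purchased when `x` is allocated, the backlog is `q` and the supply `s`. -/
def purchased (q s x : ℝ) : ℝ := if x ≤ q - s then x else max (q - s) 0

/-- The amount `x̃(t)` actually purchased by the threshold algorithm. -/
def algXt (V ε xmax : ℝ) (s a γ : ℕ → ℝ) (t : ℕ) : ℝ :=
  purchased (algQ V ε xmax s a γ t) (s t) (algX V ε xmax s a γ t)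

/-! ### First-in-first-out service and delay -/

/-- `fifoRemaining s a x t i` is the part of the requests that arrived on slot `i` still unserved at
the beginning of slot `t`, when on every slot `τ` the `s τ + x τ` units of energy serve the waiting
requests in order of arrival. The requests `a t` enter at the end of slot `t`. On slot `t`, the
batch `i` can use only what the older batches `j < i` leave over. -/
def fifoRemaining (s a x : ℕ → ℝ) : ℕ → ℕ → ℝ
  | 0, _ => 0
  | t + 1, i =>
    if i = t then a t
    else fifoRemaining s a x t i -
      min (fifoRemaining s a x t i)
        (max (s t + x t - ∑ j ∈ Finset.range i, fifoRemaining s a x t j) 0)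

/-- Every request is served with a delay of at most `D` slots: all requests that arrive on slot `i`
are fulfilled by the end of slot `i + D`. -/
def MaxDelay (s a x : ℕ → ℝ) (D : ℕ) : Prop :=
  ∀ i, fifoRemaining s a x (i + D + 1) i = 0

/-! ### The stochastic problem -/

section Stochastic

variable {Ω : Type*} [MeasurableSpace Ω]

/-- The sample path of a process at the outcome `ω`. -/
def path (X : ℕ → Ω → ℝ) (ω : Ω) : ℕ → ℝ := fun t => X t ω

/-- `(1/t) ∑_{τ < t} E[X(τ)]`. -/
def timeAvg (μ : Measure Ω) (X : ℕ → Ω → ℝ) (t : ℕ) : ℝ :=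
  (1 / (t : ℝ)) * ∑ τ ∈ Finset.range t, ∫ ω, X τ ω ∂μ

/-- The vectors `(s(t), a(t), γ(t))` are independent over slots and identically distributed. -/
def IsIID (μ : Measure Ω) (s a γ : ℕ → Ω → ℝ) : Prop :=
  iIndepFun (fun t ω => (s t ω, a t ω, γ t ω)) μ ∧
  ∀ t, IdentDistrib (fun ω => (s t ω, a t ω, γ t ω)) (fun ω => (s 0 ω, a 0 ω, γ 0 ω)) μ μ

/-- A way `x` of choosing the purchases that is feasible for the optimization problem:
`0 ≤ x(t) ≤ xmax` for all `t`, and the time average expected backlog `limsup (1/t) ∑ E[Q(τ)]` is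
finite. Decisions may be randomized, which is the role of the independent uniform variable in the
second coordinate, and may depend in any measurable way on the whole process. -/
def Feasible (μ : Measure Ω) (s a : ℕ → Ω → ℝ) (xmax : ℝ)
    (x : ℕ → Ω × unitInterval → ℝ) : Prop :=
  (∀ t, Measurable (x t)) ∧ (∀ t p, 0 ≤ x t p ∧ x t p ≤ xmax) ∧
  limsup (fun t : ℕ =>
    ((timeAvg (μ.prod volume)
      (fun τ p => queue (path s p.1) (path a p.1) (path x p) τ) t : ℝ) : EReal)) atTop < ⊤

/-- The time average cost of `x`, as a lower limit so that it is defined for every `x`; it is the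
limit whenever that exists. -/
def avgCost (μ : Measure Ω) (γ : ℕ → Ω → ℝ) (x : ℕ → Ω × unitInterval → ℝ) : ℝ :=
  liminf (timeAvg (μ.prod volume) (fun τ p => γ τ p.1 * x τ p)) atTop

/-- `c*`: the infimum time average cost over all feasible ways of choosing the purchases. -/
def optCost (μ : Measure Ω) (s a γ : ℕ → Ω → ℝ) (xmax : ℝ) : ℝ :=
  sInf {c | ∃ x, Feasible μ s a xmax x ∧ c = avgCost μ γ x}

end Stochastic

/-- The constant `B`. -/
def constB (smax amax xmax ε : ℝ) : ℝ :=
  ((smax + xmax) ^ 2 + amax ^ 2) / 2 + max (ε ^ 2) ((smax + xmax) ^ 2) / 2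

end RenewableEnergy

end

open RenewableEnergy

/-!
The queue bounds are inductions: as soon as one of the queues exceeds `V γmax`, the rule purchases
`xmax`, which outweighs every inflow. For the delay, consider the requests that arrived up to slot
`i`. Under first-in-first-out service they form a queue without arrivals, so while some of them wait
their amount drops by exactly the energy of each slot, whereas `Z` grows by `ε` minus that energy.
The amount that waits plus `ε` per elapsed slot is therefore at most `Q(i + 1)` plus the current `Z`
(`sum_fifoRemaining_add_le`), which the queue bounds contradict after `Dmax` slots.

The cost bound is a drift-plus-penalty argument for the Lyapunov function `Q² + Z²`. The threshold
rule minimizes `(V γ - Q - Z) x` over `x ∈ [0, xmax]` at every outcome, with minimum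
`xmax * min (V γ - Q - Z) 0`. For a frozen number `y` in place of `Q + Z`, the mean of this minimum
does not depend on the slot and is at most `E[(V γ(τ) - y) x(τ)]` for every slot `τ` of every policy
`x`, however much that policy knows (`integral_min_le_timeAvg`). Since this holds for all `y`, and
the state `(Q(t), Z(t))` is independent of slot `t`, it holds with `y` replaced by the random
`Q(t) + Z(t)` (`expected_drift_le`). No stationary policy has to be constructed from `x`; the
average cost and the average purchase of `x` over one finite horizon suffice.

That horizon comes from `Feasible.exists_timeAvg`. The mean backlog of a feasible policy has bounded
time averages and increases by at most `amax` per slot, so it grows sublinearly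
(`eventually_le_mul_of_sum_le`), and the average purchase is asymptotically at least
`E[a] - E[s]`. Together with the assumption on `ε` this makes the terms of the drift that are linear
in `Q` and `Z` nonpositive up to an arbitrarily small error, the queues being bounded. Summing the
drift over slots gives the claim.
-/

namespace RenewableEnergy

/-! ### The threshold rule on a sample path -/

section SamplePath

variable {V ε xmax smax amax γmax : ℝ} {s a γ x : ℕ → ℝ}

theorem algQ_succ (t : ℕ) : algQ V ε xmax s a γ (t + 1) =
    queueStep (algQ V ε xmax s a γ t) (s t) (algX V ε xmax s a γ t) (a t) := rfl

theorem algZ_succ (t : ℕ) : algZ V ε xmax s a γ (t + 1) =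
    virtualStep ε (algQ V ε xmax s a γ t) (algZ V ε xmax s a γ t) (s t)
      (algX V ε xmax s a γ t) := rfl

theorem queue_nonneg (ha : ∀ t, 0 ≤ a t) (t : ℕ) : 0 ≤ queue s a x t := by
  cases t with
  | zero => exact le_rfl
  | succ t => exact add_nonneg (le_max_right _ _) (ha t)

theorem algQ_eq_queue (t : ℕ) :
    algQ V ε xmax s a γ t = queue s a (algX V ε xmax s a γ) t := by
  induction t with
  | zero => rfl
  | succ t ih => rw [algQ_succ, ih]; rfl

theorem algQ_nonneg (ha : ∀ t, 0 ≤ a t) (t : ℕ) : 0 ≤ algQ V ε xmax s a γ t := by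
  rw [algQ_eq_queue]; exact queue_nonneg ha t

theorem algZ_nonneg (t : ℕ) : 0 ≤ algZ V ε xmax s a γ t := by
  cases t with
  | zero => exact le_rfl
  | succ t => exact le_max_right _ _

theorem threshold_mem_Icc (hx : 0 ≤ xmax) (g q z : ℝ) :
    threshold V xmax g q z ∈ Set.Icc 0 xmax := by
  unfold threshold; split_ifs <;> simp [hx]

theorem algQ_le (hV : 0 ≤ V) (hs : ∀ t, 0 ≤ s t) (ha : ∀ t, 0 ≤ a t ∧ a t ≤ amax)
    (hγ : ∀ t, 0 ≤ γ t ∧ γ t ≤ γmax) (hx : amax ≤ xmax) (t : ℕ) :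
    algQ V ε xmax s a γ t ≤ V * γmax + amax := by
  have hγmax : 0 ≤ V * γmax := mul_nonneg hV ((hγ 0).1.trans (hγ 0).2)
  have hamax : 0 ≤ amax := (ha 0).1.trans (ha 0).2
  induction t with
  | zero => exact add_nonneg hγmax hamax
  | succ t ih =>
    have hq := algQ_nonneg (V := V) (ε := ε) (xmax := xmax) (s := s) (γ := γ)
      (fun t => (ha t).1) t
    have hz := algZ_nonneg (V := V) (ε := ε) (xmax := xmax) (s := s) (a := a) (γ := γ) t
    have hVγ := mul_le_mul_of_nonneg_left (hγ t).2 hV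
    rw [algQ_succ, algX]
    set q := algQ V ε xmax s a γ t
    set z := algZ V ε xmax s a γ t
    have := hs t
    have := (ha t).2
    unfold queueStep threshold
    split_ifs <;> rcases max_cases (q - s t - _) 0 with h | h <;> rw [h.1] <;> linarith

theorem algZ_le (hV : 0 ≤ V) (hε : 0 ≤ ε) (hs : ∀ t, 0 ≤ s t) (ha : ∀ t, 0 ≤ a t)
    (hγ : ∀ t, 0 ≤ γ t ∧ γ t ≤ γmax) (hx : ε ≤ xmax) (t : ℕ) :
    algZ V ε xmax s a γ t ≤ V * γmax + ε := by
  have hγmax : 0 ≤ V * γmax := mul_nonneg hV ((hγ 0).1.trans (hγ 0).2)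
  induction t with
  | zero => exact add_nonneg hγmax hε
  | succ t ih =>
    have hq := algQ_nonneg (V := V) (ε := ε) (xmax := xmax) (s := s) (γ := γ) ha t
    have hVγ := mul_le_mul_of_nonneg_left (hγ t).2 hV
    rw [algZ_succ, algX]
    set q := algQ V ε xmax s a γ t
    set z := algZ V ε xmax s a γ t
    have := hs t
    have hind : (if 0 < q then ε else 0) ≤ ε := by split_ifs <;> linarith
    unfold virtualStep
    refine max_le ?_ (add_nonneg hγmax hε)
    unfold threshold
    split_ifs at hind ⊢ <;> linarith

theorem purchased_le {q b y : ℝ} (hy : 0 ≤ y) : purchased q b y ≤ y := by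
  unfold purchased
  split_ifs with h
  · exact le_rfl
  · exact max_le (not_le.1 h).le hy

theorem purchased_nonneg {q b y : ℝ} (hy : 0 ≤ y) : 0 ≤ purchased q b y := by
  unfold purchased
  split_ifs
  exacts [hy, le_max_right _ _]

/-! ### First-in-first-out service -/

theorem fifoRemaining_nonneg (ha : ∀ t, 0 ≤ a t) (t i : ℕ) : 0 ≤ fifoRemaining s a x t i := by
  cases t with
  | zero => exact le_rfl
  | succ t =>
    rw [fifoRemaining]
    split_ifs
    · exact ha t
    · exact sub_nonneg.2 (min_le_left _ _)

/-- Under first-in-first-out service the `n` oldest batches form a queue of their own: they receive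
all the energy and no new arrivals. -/
theorem sum_fifoRemaining_succ (ha : ∀ t, 0 ≤ a t) {t n : ℕ} (hb : 0 ≤ s t + x t) (hn : n ≤ t) :
    ∑ j ∈ Finset.range n, fifoRemaining s a x (t + 1) j =
      max (∑ j ∈ Finset.range n, fifoRemaining s a x t j - (s t + x t)) 0 := by
  induction n with
  | zero => simp only [Finset.range_zero, Finset.sum_empty, zero_sub, neg_nonpos, hb, max_eq_right]
  | succ n ih =>
    have hr := fifoRemaining_nonneg (s := s) (x := x) ha t n
    rw [Finset.sum_range_succ, ih (by omega), Finset.sum_range_succ, fifoRemaining,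
      if_neg (by omega)]
    set S := ∑ j ∈ Finset.range n, fifoRemaining s a x t j
    set r := fifoRemaining s a x t n
    rcases le_total (s t + x t) S with h | h
    · rw [max_eq_left (by linarith), max_eq_right (by linarith : s t + x t - S ≤ 0),
        min_eq_right hr, max_eq_left (by linarith)]
      ring
    · rw [max_eq_right (by linarith), max_eq_left (by linarith : 0 ≤ s t + x t - S)]
      rcases le_total r (s t + x t - S) with h' | h'
      · rw [min_eq_left h', max_eq_right (by linarith)]; ring
      · rw [min_eq_right h', max_eq_left (by linarith)]; ring

theorem sum_fifoRemaining_eq_queue (ha : ∀ t, 0 ≤ a t) (hb : ∀ t, 0 ≤ s t + x t) (t : ℕ) :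
    ∑ j ∈ Finset.range t, fifoRemaining s a x t j = queue s a x t := by
  induction t with
  | zero => simp [queue]
  | succ t ih =>
    rw [Finset.sum_range_succ, sum_fifoRemaining_succ ha (hb t) le_rfl, ih, fifoRemaining,
      if_pos rfl, queue, queueStep, sub_sub]

/-- As long as some of the requests that arrived up to slot `i` wait, `Z` grows by `ε` minus the
energy, while the amount that waits shrinks by exactly the energy. -/
theorem sum_fifoRemaining_add_le (hx : 0 ≤ xmax) (hs : ∀ t, 0 ≤ s t) (ha : ∀ t, 0 ≤ a t)
    (i k : ℕ)
    (hpos : 0 < ∑ j ∈ Finset.range (i + 1),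
      fifoRemaining s a (algX V ε xmax s a γ) (i + 1 + k) j) :
    ∑ j ∈ Finset.range (i + 1), fifoRemaining s a (algX V ε xmax s a γ) (i + 1 + k) j + k * ε ≤
      algQ V ε xmax s a γ (i + 1) + algZ V ε xmax s a γ (i + 1 + k) := by
  have hb : ∀ t, 0 ≤ s t + algX V ε xmax s a γ t :=
    fun t => add_nonneg (hs t) (threshold_mem_Icc hx _ _ _).1
  induction k with
  | zero =>
    have := algZ_nonneg (V := V) (ε := ε) (xmax := xmax) (s := s) (a := a) (γ := γ) (i + 1)
    simp only [Nat.cast_zero, zero_mul, add_zero]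
    rw [sum_fifoRemaining_eq_queue ha hb, ← algQ_eq_queue]
    linarith
  | succ k ih =>
    have hstep := sum_fifoRemaining_succ ha (hb (i + 1 + k)) (Nat.le_add_right (i + 1) k)
    rw [← add_assoc] at hpos ⊢
    rw [hstep] at hpos ⊢
    have hlt : 0 < ∑ j ∈ Finset.range (i + 1),
        fifoRemaining s a (algX V ε xmax s a γ) (i + 1 + k) j -
          (s (i + 1 + k) + algX V ε xmax s a γ (i + 1 + k)) := by
      by_contra h
      rw [max_eq_right (not_lt.1 h)] at hpos
      exact lt_irrefl _ hpos
    have hSpos := hlt.trans_le (sub_le_self _ (hb (i + 1 + k)))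
    have hQpos : 0 < algQ V ε xmax s a γ (i + 1 + k) := by
      rw [algQ_eq_queue, ← sum_fifoRemaining_eq_queue ha hb]
      exact hSpos.trans_le (Finset.sum_le_sum_of_subset_of_nonneg
        (Finset.range_subset_range.2 (by omega)) fun j _ _ => fifoRemaining_nonneg ha _ j)
    have hZ : algZ V ε xmax s a γ (i + 1 + k) - s (i + 1 + k) -
        algX V ε xmax s a γ (i + 1 + k) + ε ≤ algZ V ε xmax s a γ (i + 1 + k + 1) := by
      rw [algZ_succ, virtualStep, if_pos hQpos]
      exact le_max_left _ _
    have := ih hSpos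
    rw [max_eq_left hlt.le]
    push_cast
    linarith

theorem maxDelay_algX (hV : 0 ≤ V) (hε : 0 < ε) (hs : ∀ t, 0 ≤ s t)
    (ha : ∀ t, 0 ≤ a t ∧ a t ≤ amax) (hγ : ∀ t, 0 ≤ γ t ∧ γ t ≤ γmax) (hax : amax ≤ xmax)
    (hεx : ε ≤ xmax) :
    MaxDelay s a (algX V ε xmax s a γ) ⌈(2 * V * γmax + amax + ε) / ε⌉₊ := by
  intro i
  set D := ⌈(2 * V * γmax + amax + ε) / ε⌉₊
  have hD : 2 * V * γmax + amax + ε ≤ D * ε := (div_le_iff₀ hε).1 (Nat.le_ceil _)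
  have ha0 := fun t => (ha t).1
  refine le_antisymm (not_lt.1 fun hpos => ?_) (fifoRemaining_nonneg ha0 _ _)
  rw [add_right_comm] at hpos
  have hS := hpos.trans_le (Finset.single_le_sum
    (fun j _ => fifoRemaining_nonneg ha0 (i + 1 + D) j) (Finset.self_mem_range_succ i))
  have h := sum_fifoRemaining_add_le (hε.le.trans hεx) hs ha0 i D hS
  have hQ := algQ_le (ε := ε) hV hs ha hγ hax (i + 1)
  have hZ := algZ_le hV hε.le hs ha0 hγ hεx (i + 1 + D)
  linarith

/-! ### The one-slot drift -/

theorem queueStep_sq_le {q b y r : ℝ} (hq : 0 ≤ q) (hb : 0 ≤ b) (hy : 0 ≤ y) (hr : 0 ≤ r) :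
    queueStep q b y r ^ 2 ≤ q ^ 2 + (b + y) ^ 2 + r ^ 2 + 2 * q * (r - b - y) := by
  unfold queueStep
  rcases max_cases (q - b - y) 0 with h | h <;> rw [h.1]
  · nlinarith [mul_nonneg hr (add_nonneg hb hy)]
  · nlinarith [mul_nonneg hq hr, sq_nonneg (q - b - y)]

theorem virtualStep_sq_le {q z b y : ℝ} (hε : 0 ≤ ε) (hz : 0 ≤ z) (hb : 0 ≤ b ∧ b ≤ smax)
    (hy : 0 ≤ y ∧ y ≤ xmax) :
    virtualStep ε q z b y ^ 2 ≤
      z ^ 2 + max (ε ^ 2) ((smax + xmax) ^ 2) + 2 * z * (ε - b - y) := by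
  unfold virtualStep
  obtain ⟨e, he, he0, heε⟩ : ∃ e, (if 0 < q then ε else 0) = e ∧ 0 ≤ e ∧ e ≤ ε :=
    ⟨_, rfl, by split_ifs <;> simp [hε], by split_ifs <;> simp [hε]⟩
  rw [he]
  have hsq : (e - (b + y)) ^ 2 ≤ max (ε ^ 2) ((smax + xmax) ^ 2) := by
    rcases le_total (b + y) e with h | h
    · exact le_max_of_le_left (pow_le_pow_left₀ (by linarith) (by linarith) 2)
    · refine le_max_of_le_right ?_
      rw [← neg_sq]
      exact pow_le_pow_left₀ (by linarith) (by linarith) 2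
  have hmax : max (z - b - y + e) 0 ^ 2 ≤ (z + (e - (b + y))) ^ 2 := by
    rcases max_cases (z - b - y + e) 0 with h | h <;> rw [h.1]
    · exact le_of_eq (by ring)
    · simpa using sq_nonneg (z + (e - (b + y)))
  nlinarith [mul_le_mul_of_nonneg_left heε hz]

/-- The threshold rule minimizes `(V g - q - z) y` over `y ∈ [0, xmax]`. -/
theorem mul_threshold (g q z : ℝ) :
    (V * g - (q + z)) * threshold V xmax g q z = xmax * min (V * g - (q + z)) 0 := by
  unfold threshold
  split_ifs with h
  · rw [min_eq_right (by linarith)]; ring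
  · rw [min_eq_left (by linarith)]; ring

theorem mul_min_zero_le {v y : ℝ} (hy : 0 ≤ y ∧ y ≤ xmax) : xmax * min v 0 ≤ v * y := by
  rcases le_total v 0 with h | h
  · rw [min_eq_left h]; nlinarith [hy.2]
  · rw [min_eq_right h]; nlinarith [hy.1]

theorem drift_le (hx : 0 ≤ xmax) (hε : 0 ≤ ε) (hs : ∀ t, 0 ≤ s t ∧ s t ≤ smax)
    (ha : ∀ t, 0 ≤ a t ∧ a t ≤ amax) (t : ℕ) :
    algQ V ε xmax s a γ (t + 1) ^ 2 + algZ V ε xmax s a γ (t + 1) ^ 2 +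
        2 * V * (γ t * algX V ε xmax s a γ t) ≤
      algQ V ε xmax s a γ t ^ 2 + algZ V ε xmax s a γ t ^ 2 + 2 * constB smax amax xmax ε +
        2 * (algQ V ε xmax s a γ t * (a t - s t)) + 2 * (algZ V ε xmax s a γ t * (ε - s t)) +
        2 * (xmax * min (V * γ t - (algQ V ε xmax s a γ t + algZ V ε xmax s a γ t)) 0) := by
  have hX := threshold_mem_Icc (V := V) hx (γ t) (algQ V ε xmax s a γ t) (algZ V ε xmax s a γ t)
  have hQ := queueStep_sq_le (algQ_nonneg (V := V) (ε := ε) (xmax := xmax) (s := s) (γ := γ)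
    (fun t => (ha t).1) t) (hs t).1 hX.1 (ha t).1
  have hZ := virtualStep_sq_le (q := algQ V ε xmax s a γ t) hε
    (algZ_nonneg (V := V) (ε := ε) (xmax := xmax) (s := s) (a := a) (γ := γ) t) (hs t) hX
  have h1 : (s t + threshold V xmax (γ t) (algQ V ε xmax s a γ t) (algZ V ε xmax s a γ t)) ^ 2 ≤
      (smax + xmax) ^ 2 :=
    pow_le_pow_left₀ (add_nonneg (hs t).1 hX.1) (add_le_add (hs t).2 hX.2) 2
  have h2 : a t ^ 2 ≤ amax ^ 2 := pow_le_pow_left₀ (ha t).1 (ha t).2 2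
  rw [algQ_succ, algZ_succ, algX, ← mul_threshold, constB]
  linarith

/-! ### Backlogs of arbitrary policies -/

theorem sum_le_queue (t : ℕ) :
    ∑ τ ∈ Finset.range t, (a τ - s τ - x τ) ≤ queue s a x t := by
  induction t with
  | zero => simp [queue]
  | succ t ih =>
    rw [Finset.sum_range_succ, queue, queueStep]
    linarith [le_max_left (queue s a x t - s t - x t) 0]

theorem queue_succ_le (hs : ∀ t, 0 ≤ s t) (ha : ∀ t, 0 ≤ a t ∧ a t ≤ amax) (hx : ∀ t, 0 ≤ x t)
    (t : ℕ) : queue s a x (t + 1) ≤ queue s a x t + amax := by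
  rw [queue, queueStep]
  have := queue_nonneg (s := s) (x := x) (fun t => (ha t).1) t
  exact add_le_add (max_le (by linarith [hs t, hx t]) this) (ha t).2

theorem queue_le (hs : ∀ t, 0 ≤ s t) (ha : ∀ t, 0 ≤ a t ∧ a t ≤ amax) (hx : ∀ t, 0 ≤ x t)
    (t : ℕ) : queue s a x t ≤ t * amax := by
  induction t with
  | zero => simp [queue]
  | succ t ih =>
    have := queue_succ_le hs ha hx t
    push_cast
    linarith

/-- Allocating at least `amax` on every slot clears the whole backlog on every slot. -/
theorem queue_const_le (hs : ∀ t, 0 ≤ s t) (ha : ∀ t, 0 ≤ a t ∧ a t ≤ amax) (hx : amax ≤ xmax)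
    (t : ℕ) : queue s a (fun _ => xmax) t ≤ amax := by
  have h0 : 0 ≤ amax := (ha 0).1.trans (ha 0).2
  induction t with
  | zero => exact h0
  | succ t ih =>
    rw [queue, queueStep, max_eq_right (by linarith [hs t])]
    linarith [(ha t).2]

/-- A nonnegative sequence with increments bounded above and bounded Cesàro means grows
sublinearly. Telescoping `u (t + 1) ^ 2 ≤ u t ^ 2 + 2 A u t + A ^ 2` gives `u T ^ 2 = O(T)`. -/
theorem eventually_le_mul_of_sum_le {u : ℕ → ℝ} {A K : ℝ} (h0 : u 0 = 0) (hu : ∀ t, 0 ≤ u t)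
    (hA : 0 ≤ A) (hstep : ∀ t, u (t + 1) ≤ u t + A)
    (hsum : ∀ᶠ T : ℕ in atTop, ∑ τ ∈ Finset.range T, u τ ≤ K * T) {δ : ℝ} (hδ : 0 < δ) :
    ∀ᶠ T : ℕ in atTop, u T ≤ δ * T := by
  have hsq : ∀ T : ℕ, u T ^ 2 ≤ 2 * A * ∑ τ ∈ Finset.range T, u τ + A ^ 2 * T := by
    intro T
    induction T with
    | zero => simp [h0]
    | succ T ih =>
      have := pow_le_pow_left₀ (hu (T + 1)) (hstep T) 2
      rw [Finset.sum_range_succ]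
      push_cast
      linarith
  obtain ⟨N, hN⟩ := exists_nat_gt ((2 * A * K + A ^ 2) / δ ^ 2)
  rw [div_lt_iff₀ (by positivity)] at hN
  filter_upwards [hsum, eventually_ge_atTop N] with T hT hNT
  have hNT' : (N : ℝ) ≤ T := by exact_mod_cast hNT
  refine le_of_sq_le_sq ?_ (by positivity)
  have h1 := mul_le_mul_of_nonneg_left hT (by positivity : 0 ≤ 2 * A)
  have h2 := mul_le_mul_of_nonneg_right hNT' (sq_nonneg δ)
  have h3 := mul_le_mul_of_nonneg_right (hN.le.trans h2) (Nat.cast_nonneg (α := ℝ) T)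
  linarith [hsq T]

end SamplePath

/-! ### Measurability and independence -/

section Measurability

variable {Ω : Type*} [MeasurableSpace Ω] {s a γ : ℕ → Ω → ℝ} {V ε xmax : ℝ}

theorem measurable_queue {x : ℕ → Ω → ℝ} (hs : ∀ t, Measurable (s t)) (ha : ∀ t, Measurable (a t))
    (hx : ∀ t, Measurable (x t)) (t : ℕ) :
    Measurable fun ω => queue (path s ω) (path a ω) (path x ω) t := by
  induction t with
  | zero => exact measurable_const
  | succ t ih => exact (((ih.sub (hs t)).sub (hx t)).max measurable_const).add (ha t)

theorem measurable_threshold {g q z : Ω → ℝ} (hg : Measurable g) (hq : Measurable q)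
    (hz : Measurable z) : Measurable fun ω => threshold V xmax (g ω) (q ω) (z ω) :=
  Measurable.ite (measurableSet_le (hq.add hz) (hg.const_mul V)) measurable_const measurable_const

/-- The state at time `t` is a function of the slots before `t` only. -/
theorem measurable_algState {t : ℕ} (hs : ∀ i < t, Measurable (s i))
    (ha : ∀ i < t, Measurable (a i)) (hγ : ∀ i < t, Measurable (γ i)) :
    Measurable fun ω => algState V ε xmax (path s ω) (path a ω) (path γ ω) t := by
  induction t with
  | zero => exact measurable_const
  | succ t ih =>
    have h := ih (fun i hi => hs i (by omega)) (fun i hi => ha i (by omega))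
      (fun i hi => hγ i (by omega))
    have hX := measurable_threshold (V := V) (xmax := xmax) (hγ t t.lt_succ_self) h.fst h.snd
    have hs' := hs t t.lt_succ_self
    exact ((((h.fst.sub hs').sub hX).max measurable_const).add (ha t t.lt_succ_self)).prodMk
      ((((h.snd.sub hs').sub hX).add (Measurable.ite (measurableSet_lt measurable_const h.fst)
        measurable_const measurable_const)).max measurable_const)

theorem indepFun_algState {μ : Measure Ω} (hs : ∀ t, Measurable (s t))
    (ha : ∀ t, Measurable (a t)) (hγ : ∀ t, Measurable (γ t))
    (hind : iIndepFun (fun t ω => (s t ω, a t ω, γ t ω)) μ) (t : ℕ) :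
    IndepFun (fun ω => (s t ω, a t ω, γ t ω))
      (fun ω => algState V ε xmax (path s ω) (path a ω) (path γ ω) t) μ := by
  let m : ℕ → MeasurableSpace Ω := fun i =>
    MeasurableSpace.comap (fun ω => (s i ω, a i ω, γ i ω)) inferInstance
  have hle : ∀ i, m i ≤ ‹MeasurableSpace Ω› := fun i =>
    ((hs i).prodMk ((ha i).prodMk (hγ i))).comap_le
  have h := indep_iSup_of_disjoint hle hind (S := {t}) (T := Set.Iio t) (by simp)
  refine indep_of_indep_of_le_right (indep_of_indep_of_le_left h (le_iSup₂_of_le t rfl le_rfl)) ?_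
  have hW : ∀ i < t, Measurable[⨆ j ∈ Set.Iio t, m j] fun ω => (s i ω, a i ω, γ i ω) := fun i hi =>
    (comap_measurable (fun ω => (s i ω, a i ω, γ i ω))).mono
      (le_iSup₂_of_le (f := fun j (_ : j ∈ Set.Iio t) => m j) i hi le_rfl) le_rfl
  exact (@measurable_algState Ω (⨆ j ∈ Set.Iio t, m j) s a γ V ε xmax t
    (fun i hi => measurable_fst.comp (hW i hi))
    (fun i hi => measurable_fst.comp (measurable_snd.comp (hW i hi)))
    (fun i hi => measurable_snd.comp (measurable_snd.comp (hW i hi)))).comap_le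

/-- Freezing an independent variable: a bound on `E[F (X, y)]` for every fixed `y` may be
integrated over an independent `Y`. -/
theorem integral_le_of_indepFun {α β : Type*} [MeasurableSpace α] [MeasurableSpace β]
    {μ : Measure Ω} [IsProbabilityMeasure μ] {X : Ω → α} {Y : Ω → β} (hX : Measurable X)
    (hY : Measurable Y) (h : IndepFun X Y μ) {F : α × β → ℝ} (hF : Measurable F)
    (hFi : Integrable (fun ω => F (X ω, Y ω)) μ) {G : β → ℝ} (hG : Measurable G)
    (hGi : Integrable (fun ω => G (Y ω)) μ) (hle : ∀ y, ∫ ω, F (X ω, y) ∂μ ≤ G y) :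
    ∫ ω, F (X ω, Y ω) ∂μ ≤ ∫ ω, G (Y ω) ∂μ := by
  have hmap := (indepFun_iff_map_prod_eq_prod_map_map hX.aemeasurable hY.aemeasurable).1 h
  have := Measure.isProbabilityMeasure_map (μ := μ) hX.aemeasurable
  have := Measure.isProbabilityMeasure_map (μ := μ) hY.aemeasurable
  have hFi' : Integrable F ((μ.map X).prod (μ.map Y)) := by
    rw [← hmap]
    exact (integrable_map_measure hF.aestronglyMeasurable (hX.prodMk hY).aemeasurable).2 hFi
  have hGi' : Integrable G (μ.map Y) :=
    (integrable_map_measure hG.aestronglyMeasurable hY.aemeasurable).2 hGi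
  rw [← integral_map (φ := fun ω => (X ω, Y ω)) (hX.prodMk hY).aemeasurable
    hF.aestronglyMeasurable, ← integral_map hY.aemeasurable hG.aestronglyMeasurable, hmap,
    integral_prod_symm _ hFi']
  refine integral_mono hFi'.integral_prod_right hGi' fun y => ?_
  have hFy : Measurable fun x => F (x, y) := hF.comp measurable_prodMk_right
  exact (integral_map hX.aemeasurable hFy.aestronglyMeasurable).trans_le (hle y)

end Measurability

/-! ### Time averages of feasible policies -/

section Policies

variable {Ω : Type*} [MeasurableSpace Ω] {μ : Measure Ω}
  {s a γ : ℕ → Ω → ℝ} {smax amax γmax xmax V : ℝ}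

theorem le_timeAvg_iff {X : ℕ → Ω → ℝ} {T : ℕ} (hT : 0 < T) {c : ℝ} :
    c ≤ timeAvg μ X T ↔ T * c ≤ ∑ τ ∈ Finset.range T, ∫ ω, X τ ω ∂μ := by
  rw [timeAvg, one_div_mul_eq_div, le_div_iff₀' (by exact_mod_cast hT)]

theorem timeAvg_le_iff {X : ℕ → Ω → ℝ} {T : ℕ} (hT : 0 < T) {c : ℝ} :
    timeAvg μ X T ≤ c ↔ ∑ τ ∈ Finset.range T, ∫ ω, X τ ω ∂μ ≤ T * c := by
  rw [timeAvg, one_div_mul_eq_div, div_le_iff₀' (by exact_mod_cast hT)]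

theorem timeAvg_le {X : ℕ → Ω → ℝ} {T : ℕ} (hT : 0 < T) {c : ℝ}
    (h : ∀ τ, ∫ ω, X τ ω ∂μ ≤ c) : timeAvg μ X T ≤ c :=
  (timeAvg_le_iff hT).2 ((Finset.sum_le_card_nsmul _ _ c fun τ _ => h τ).trans_eq (by simp))

theorem timeAvg_nonneg {X : ℕ → Ω → ℝ} (T : ℕ) (h : ∀ τ, 0 ≤ ∫ ω, X τ ω ∂μ) :
    0 ≤ timeAvg μ X T :=
  mul_nonneg (by positivity) (Finset.sum_nonneg fun τ _ => h τ)

variable [IsProbabilityMeasure μ]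

theorem integrable_of_mem_Icc {f : Ω → ℝ} {l u : ℝ} (hf : Measurable f)
    (h : ∀ ω, l ≤ f ω ∧ f ω ≤ u) : Integrable f μ :=
  .of_mem_Icc l u hf.aemeasurable (ae_of_all _ h)

theorem integral_mem_Icc {f : Ω → ℝ} {l u : ℝ} (hf : Measurable f)
    (h : ∀ ω, l ≤ f ω ∧ f ω ≤ u) : l ≤ ∫ ω, f ω ∂μ ∧ ∫ ω, f ω ∂μ ≤ u := by
  have hi := integrable_of_mem_Icc (μ := μ) hf h
  exact ⟨by simpa using integral_mono (integrable_const l) hi fun ω => (h ω).1,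
    by simpa using integral_mono hi (integrable_const u) fun ω => (h ω).2⟩

/-- A feasible policy purchases, up to `δ` and over suitable horizons, at least the mean excess of
the requests over the supply, while its average cost is near the lower limit. -/
theorem Feasible.exists_timeAvg {x : ℕ → Ω × unitInterval → ℝ} {c δ : ℝ}
    (hfeas : Feasible μ s a xmax x)
    (hs_meas : ∀ t, Measurable (s t)) (ha_meas : ∀ t, Measurable (a t))
    (hγ_meas : ∀ t, Measurable (γ t))
    (hs : ∀ t ω, 0 ≤ s t ω ∧ s t ω ≤ smax) (ha : ∀ t ω, 0 ≤ a t ω ∧ a t ω ≤ amax)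
    (hγ : ∀ t ω, 0 ≤ γ t ω ∧ γ t ω ≤ γmax)
    (hEs : ∀ t, ∫ ω, s t ω ∂μ = ∫ ω, s 0 ω ∂μ) (hEa : ∀ t, ∫ ω, a t ω ∂μ = ∫ ω, a 0 ω ∂μ)
    (hc : avgCost μ γ x < c) (hδ : 0 < δ) :
    ∃ T : ℕ, 0 < T ∧ timeAvg (μ.prod volume) (fun τ p => γ τ p.1 * x τ p) T < c ∧
      ∫ ω, a 0 ω ∂μ - ∫ ω, s 0 ω ∂μ ≤ timeAvg (μ.prod volume) x T + δ := by
  obtain ⟨hx_meas, hx, hlim⟩ := hfeas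
  obtain ⟨ω₀⟩ := μ.nonempty_of_neZero
  have hamax : 0 ≤ amax := (ha 0 ω₀).1.trans (ha 0 ω₀).2
  let q : ℕ → Ω × unitInterval → ℝ :=
    fun τ p => queue (path s p.1) (path a p.1) (path x p) τ
  have hq_meas : ∀ t, Measurable (q t) := measurable_queue
    (s := fun t (p : Ω × unitInterval) => s t p.1) (a := fun t p => a t p.1)
    (fun t => (hs_meas t).comp measurable_fst) (fun t => (ha_meas t).comp measurable_fst) hx_meas
  have hq : ∀ t p, 0 ≤ q t p ∧ q t p ≤ t * amax := fun t p =>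
    ⟨queue_nonneg (fun t => (ha t p.1).1) t,
      queue_le (fun t => (hs t p.1).1) (fun t => ha t p.1) (fun t => (hx t p).1) t⟩
  have hq_int : ∀ t, Integrable (q t) (μ.prod volume) :=
    fun t => integrable_of_mem_Icc (hq_meas t) (hq t)
  have hx_int : ∀ t, Integrable (x t) (μ.prod volume) :=
    fun t => integrable_of_mem_Icc (hx_meas t) (hx t)
  have hs_int : ∀ t, Integrable (fun p : Ω × unitInterval => s t p.1) (μ.prod volume) :=
    fun t => integrable_of_mem_Icc ((hs_meas t).comp measurable_fst) fun p => hs t p.1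
  have ha_int : ∀ t, Integrable (fun p : Ω × unitInterval => a t p.1) (μ.prod volume) :=
    fun t => integrable_of_mem_Icc ((ha_meas t).comp measurable_fst) fun p => ha t p.1
  obtain ⟨K, hK, -⟩ := EReal.lt_iff_exists_real_btwn.1 hlim
  have hsum : ∀ᶠ T : ℕ in atTop,
      ∑ τ ∈ Finset.range T, ∫ p, q τ p ∂(μ.prod volume) ≤ K * T := by
    filter_upwards [eventually_lt_of_limsup_lt hK, eventually_gt_atTop 0] with T hT hT0
    rw [mul_comm]
    exact (timeAvg_le_iff hT0).1 (EReal.coe_lt_coe_iff.1 hT).le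
  have hgrowth := eventually_le_mul_of_sum_le (u := fun t => ∫ p, q t p ∂(μ.prod volume))
    (A := amax) (by simp [q, queue]) (fun t => integral_nonneg fun p => (hq t p).1) hamax
    (fun t => by
      have := integral_mono (hq_int (t + 1)) ((hq_int t).add (integrable_const amax)) fun p =>
        queue_succ_le (fun t => (hs t p.1).1) (fun t => ha t p.1) (fun t => (hx t p).1) t
      simpa [integral_add (hq_int t) (integrable_const amax)] using this) hsum hδ
  have hbdd : IsBoundedUnder (· ≤ ·) atTop
      (timeAvg (μ.prod volume) fun τ p => γ τ p.1 * x τ p) := by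
    refine ⟨γmax * xmax, ?_⟩
    rw [eventually_map]
    filter_upwards [eventually_gt_atTop 0] with T hT
    exact timeAvg_le hT fun τ => (integral_mem_Icc (l := 0)
      (((hγ_meas τ).comp measurable_fst).mul (hx_meas τ)) fun p =>
        ⟨mul_nonneg (hγ τ p.1).1 (hx τ p).1, mul_le_mul (hγ τ p.1).2 (hx τ p).2 (hx τ p).1
          ((hγ τ p.1).1.trans (hγ τ p.1).2)⟩).2
  obtain ⟨T, hTc, hTq, hT⟩ := ((frequently_lt_of_liminf_lt hbdd.isCoboundedUnder_ge
    hc).and_eventually (hgrowth.and (eventually_gt_atTop 0))).exists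
  refine ⟨T, hT, hTc, ?_⟩
  rw [← sub_le_iff_le_add, le_timeAvg_iff hT]
  have has_int : ∀ t, Integrable (fun p : Ω × unitInterval => a t p.1 - s t p.1)
      (μ.prod volume) := fun t => (ha_int t).sub (hs_int t)
  have hasx_int : ∀ t, Integrable (fun p => a t p.1 - s t p.1 - x t p) (μ.prod volume) :=
    fun t => (has_int t).sub (hx_int t)
  have hlow : ∑ τ ∈ Finset.range T, ∫ p, (a τ p.1 - s τ p.1 - x τ p) ∂(μ.prod volume) ≤
      ∫ p, q T p ∂(μ.prod volume) := by
    rw [← integral_finsetSum _ fun τ _ => hasx_int τ]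
    exact integral_mono (integrable_finsetSum _ fun τ _ => hasx_int τ) (hq_int T)
      fun p => sum_le_queue T
  have hterm : ∀ τ, ∫ p, (a τ p.1 - s τ p.1 - x τ p) ∂(μ.prod volume) =
      ∫ ω, a 0 ω ∂μ - ∫ ω, s 0 ω ∂μ - ∫ p, x τ p ∂(μ.prod volume) := by
    intro τ
    rw [integral_sub (has_int τ) (hx_int τ), integral_sub (ha_int τ) (hs_int τ),
      integral_fun_fst (a τ), integral_fun_fst (s τ), hEa, hEs]
    simp
  simp only [hterm, Finset.sum_sub_distrib, Finset.sum_const, Finset.card_range,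
    nsmul_eq_mul] at hlow
  linarith

/-- For a frozen weight `y`, the threshold decision has the least mean of `(V γ - y) x` among all
decisions, whatever they know, because it is the minimizer at every outcome. As the prices are
identically distributed, this compares it with any slot of any policy, hence with time averages. -/
theorem integral_min_le_timeAvg {x : ℕ → Ω × unitInterval → ℝ}
    (hx_meas : ∀ t, Measurable (x t)) (hx : ∀ t p, 0 ≤ x t p ∧ x t p ≤ xmax)
    (hγ_meas : ∀ t, Measurable (γ t)) (hγ : ∀ t ω, 0 ≤ γ t ω ∧ γ t ω ≤ γmax)
    (hγ_id : ∀ t, IdentDistrib (γ t) (γ 0) μ μ) {T : ℕ} (hT : 0 < T) (y : ℝ) :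
    ∫ ω, xmax * min (V * γ 0 ω - y) 0 ∂μ ≤
      V * timeAvg (μ.prod volume) (fun τ p => γ τ p.1 * x τ p) T -
        y * timeAvg (μ.prod volume) x T := by
  have hF : Measurable fun g : ℝ => xmax * min (V * g - y) 0 := by fun_prop
  have hx_int : ∀ t, Integrable (x t) (μ.prod volume) :=
    fun t => integrable_of_mem_Icc (hx_meas t) (hx t)
  have hγ_int : ∀ t, Integrable (γ t) μ := fun t => integrable_of_mem_Icc (hγ_meas t) (hγ t)
  have hγx_int : ∀ t, Integrable (fun p => γ t p.1 * x t p) (μ.prod volume) := fun t =>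
    integrable_of_mem_Icc (l := 0) (u := γmax * xmax)
      (((hγ_meas t).comp measurable_fst).mul (hx_meas t)) fun p =>
        ⟨mul_nonneg (hγ t p.1).1 (hx t p).1, mul_le_mul (hγ t p.1).2 (hx t p).2 (hx t p).1
          ((hγ t p.1).1.trans (hγ t p.1).2)⟩
  have hslot : ∀ τ, ∫ ω, xmax * min (V * γ 0 ω - y) 0 ∂μ ≤
      V * ∫ p, γ τ p.1 * x τ p ∂(μ.prod volume) - y * ∫ p, x τ p ∂(μ.prod volume) := by
    intro τ
    have hint : Integrable (fun ω => xmax * min (V * γ τ ω - y) 0) μ :=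
      ((((hγ_int τ).const_mul V).sub (integrable_const y)).inf (integrable_const 0)).const_mul xmax
    calc ∫ ω, xmax * min (V * γ 0 ω - y) 0 ∂μ
        = ∫ ω, xmax * min (V * γ τ ω - y) 0 ∂μ := ((hγ_id τ).comp hF).integral_eq.symm
      _ = ∫ p, xmax * min (V * γ τ p.1 - y) 0 ∂(μ.prod (volume : Measure unitInterval)) := by
          rw [integral_fun_fst (f := fun ω => xmax * min (V * γ τ ω - y) 0)]; simp
      _ ≤ ∫ p, (V * (γ τ p.1 * x τ p) - y * x τ p) ∂(μ.prod volume) :=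
          integral_mono (hint.comp_fst volume) (((hγx_int τ).const_mul V).sub
            ((hx_int τ).const_mul y)) fun p => (mul_min_zero_le (hx τ p)).trans_eq (by ring)
      _ = _ := by
          rw [integral_sub ((hγx_int τ).const_mul V) ((hx_int τ).const_mul y),
            integral_const_mul, integral_const_mul]
  have hsum := Finset.card_nsmul_le_sum (Finset.range T) _ _ fun τ _ => hslot τ
  rw [Finset.card_range, nsmul_eq_mul, Finset.sum_sub_distrib, ← Finset.mul_sum,
    ← Finset.mul_sum] at hsum
  have hT' : (0 : ℝ) < T := by exact_mod_cast hT
  rw [timeAvg, timeAvg]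
  refine le_of_mul_le_mul_left (hsum.trans_eq ?_) hT'
  field_simp

/-- Feasible policies exist, so the infimum defining `optCost` is over a nonempty set. -/
theorem feasible_const (hs_meas : ∀ t, Measurable (s t)) (ha_meas : ∀ t, Measurable (a t))
    (hs : ∀ t ω, 0 ≤ s t ω ∧ s t ω ≤ smax) (ha : ∀ t ω, 0 ≤ a t ω ∧ a t ω ≤ amax)
    (hx : amax ≤ xmax) : Feasible μ s a xmax fun _ _ => xmax := by
  obtain ⟨ω₀⟩ := μ.nonempty_of_neZero
  have hxmax : 0 ≤ xmax := (ha 0 ω₀).1.trans ((ha 0 ω₀).2.trans hx)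
  refine ⟨fun _ => measurable_const, fun _ _ => ⟨hxmax, le_rfl⟩, ?_⟩
  refine (limsup_le_of_le (a := (amax : EReal)) (by isBoundedDefault) ?_).trans_lt
    (EReal.coe_lt_top amax)
  filter_upwards [eventually_gt_atTop 0] with T hT
  refine EReal.coe_le_coe_iff.2 (timeAvg_le hT fun τ => (integral_mem_Icc (l := 0)
    (measurable_queue (s := fun t (p : Ω × unitInterval) => s t p.1) (a := fun t p => a t p.1)
      (x := fun _ _ => xmax) (fun t => (hs_meas t).comp measurable_fst)
      (fun t => (ha_meas t).comp measurable_fst) (fun _ => measurable_const) τ) fun p =>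
    ⟨queue_nonneg (fun t => (ha t p.1).1) τ,
      queue_const_le (fun t => (hs t p.1).1) (fun t => ha t p.1) hx τ⟩).2)

end Policies

/-! ### The expected drift under the threshold rule -/

section ExpectedDrift

variable {Ω : Type*} [MeasurableSpace Ω] {μ : Measure Ω} [IsProbabilityMeasure μ]
  {s a γ : ℕ → Ω → ℝ} {smax amax γmax xmax ε V : ℝ}

/-- The numbers `c` and `m` play the role of the mean cost and the mean purchase of a policy that
ignores the queues. By `hcm` the threshold rule does at least as well for every frozen value `y` of
`Q + Z`, and the independence of the current slot from the state unfreezes `y`. The slack `δ` by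
which the policy may fail to stabilize the queues is multiplied by the queue bounds. -/
theorem expected_drift_le
    (hs_meas : ∀ t, Measurable (s t)) (ha_meas : ∀ t, Measurable (a t))
    (hγ_meas : ∀ t, Measurable (γ t))
    (hs : ∀ t ω, 0 ≤ s t ω ∧ s t ω ≤ smax) (ha : ∀ t ω, 0 ≤ a t ω ∧ a t ω ≤ amax)
    (hγ : ∀ t ω, 0 ≤ γ t ω ∧ γ t ω ≤ γmax)
    (hε : 0 ≤ ε) (hV : 0 ≤ V) (hax : amax ≤ xmax) (hεx : ε ≤ xmax) (hiid : IsIID μ s a γ)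
    {c m δ : ℝ} (hδ : 0 ≤ δ)
    (hcm : ∀ y, ∫ ω, xmax * min (V * γ 0 ω - y) 0 ∂μ ≤ V * c - y * m)
    (hm : ∫ ω, a 0 ω ∂μ - ∫ ω, s 0 ω ∂μ ≤ m + δ) (hmε : ε - ∫ ω, s 0 ω ∂μ ≤ m + δ) (t : ℕ) :
    ∫ ω, (algQ V ε xmax (path s ω) (path a ω) (path γ ω) (t + 1) ^ 2 +
          algZ V ε xmax (path s ω) (path a ω) (path γ ω) (t + 1) ^ 2) ∂μ +
        2 * V * ∫ ω, γ t ω * algX V ε xmax (path s ω) (path a ω) (path γ ω) t ∂μ ≤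
      ∫ ω, (algQ V ε xmax (path s ω) (path a ω) (path γ ω) t ^ 2 +
          algZ V ε xmax (path s ω) (path a ω) (path γ ω) t ^ 2) ∂μ +
        2 * constB smax amax xmax ε + 2 * (V * c) +
        2 * (δ * ((V * γmax + amax) + (V * γmax + ε))) := by
  have hxmax : 0 ≤ xmax := hε.trans hεx
  let W : Ω → ℝ × ℝ × ℝ := fun ω => (s t ω, a t ω, γ t ω)
  let Y : ℕ → Ω → ℝ × ℝ :=
    fun t ω => algState V ε xmax (path s ω) (path a ω) (path γ ω) t
  let Q : ℕ → Ω → ℝ := fun t ω => algQ V ε xmax (path s ω) (path a ω) (path γ ω) t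
  let Z : ℕ → Ω → ℝ := fun t ω => algZ V ε xmax (path s ω) (path a ω) (path γ ω) t
  let X : Ω → ℝ := fun ω => algX V ε xmax (path s ω) (path a ω) (path γ ω) t
  have hY_meas : ∀ t, Measurable (Y t) := fun t => measurable_algState (fun i _ => hs_meas i)
    (fun i _ => ha_meas i) fun i _ => hγ_meas i
  have hQ_meas : ∀ t, Measurable (Q t) := fun t => (hY_meas t).fst
  have hZ_meas : ∀ t, Measurable (Z t) := fun t => (hY_meas t).snd
  have hX_meas : Measurable X := measurable_threshold (hγ_meas t) (hQ_meas t) (hZ_meas t)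
  have hQ : ∀ t ω, 0 ≤ Q t ω ∧ Q t ω ≤ V * γmax + amax := fun t ω =>
    ⟨algQ_nonneg (fun t => (ha t ω).1) t,
      algQ_le hV (fun t => (hs t ω).1) (fun t => ha t ω) (fun t => hγ t ω) hax t⟩
  have hZ : ∀ t ω, 0 ≤ Z t ω ∧ Z t ω ≤ V * γmax + ε := fun t ω =>
    ⟨algZ_nonneg t, algZ_le hV hε (fun t => (hs t ω).1) (fun t => (ha t ω).1)
      (fun t => hγ t ω) hεx t⟩
  have hX : ∀ ω, 0 ≤ X ω ∧ X ω ≤ xmax := fun ω => threshold_mem_Icc hxmax _ _ _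
  have hs_int : Integrable (s t) μ := integrable_of_mem_Icc (hs_meas t) (hs t)
  have ha_int : Integrable (a t) μ := integrable_of_mem_Icc (ha_meas t) (ha t)
  have hγ_int : Integrable (γ t) μ := integrable_of_mem_Icc (hγ_meas t) (hγ t)
  have hQ_int : ∀ t, Integrable (Q t) μ := fun t => integrable_of_mem_Icc (hQ_meas t) (hQ t)
  have hZ_int : ∀ t, Integrable (Z t) μ := fun t => integrable_of_mem_Icc (hZ_meas t) (hZ t)
  have hL_int : ∀ t, Integrable (fun ω => Q t ω ^ 2 + Z t ω ^ 2) μ := fun t =>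
    (integrable_of_mem_Icc ((hQ_meas t).pow_const 2) fun ω => ⟨sq_nonneg _,
      pow_le_pow_left₀ (hQ t ω).1 (hQ t ω).2 2⟩).add
    (integrable_of_mem_Icc ((hZ_meas t).pow_const 2) fun ω => ⟨sq_nonneg _,
      pow_le_pow_left₀ (hZ t ω).1 (hZ t ω).2 2⟩)
  have hγX_int : Integrable (fun ω => γ t ω * X ω) μ := integrable_of_mem_Icc (l := 0)
    (u := γmax * xmax) ((hγ_meas t).mul hX_meas) fun ω =>
      ⟨mul_nonneg (hγ t ω).1 (hX ω).1, mul_le_mul (hγ t ω).2 (hX ω).2 (hX ω).1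
        ((hγ t ω).1.trans (hγ t ω).2)⟩
  have hind : IndepFun W (Y t) μ := indepFun_algState hs_meas ha_meas hγ_meas hiid.1 t
  have hEs : ∫ ω, s t ω ∂μ = ∫ ω, s 0 ω ∂μ := ((hiid.2 t).comp measurable_fst).integral_eq
  have hEa : ∫ ω, a t ω ∂μ = ∫ ω, a 0 ω ∂μ :=
    ((hiid.2 t).comp (measurable_fst.comp measurable_snd)).integral_eq
  have hγ_id : IdentDistrib (γ t) (γ 0) μ μ :=
    (hiid.2 t).comp (measurable_snd.comp measurable_snd)
  have hindQ : IndepFun (Q t) (fun ω => a t ω - s t ω) μ :=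
    (hind.comp (φ := fun w : ℝ × ℝ × ℝ => w.2.1 - w.1) (ψ := Prod.fst) (by fun_prop)
      (by fun_prop)).symm
  have hindZ : IndepFun (Z t) (fun ω => ε - s t ω) μ :=
    (hind.comp (φ := fun w : ℝ × ℝ × ℝ => ε - w.1) (ψ := Prod.snd) (by fun_prop) (by fun_prop)).symm
  have hindγ : IndepFun (γ t) (fun ω => Q t ω + Z t ω) μ :=
    hind.comp (φ := fun w : ℝ × ℝ × ℝ => w.2.2) (ψ := fun y : ℝ × ℝ => y.1 + y.2) (by fun_prop)
      (by fun_prop)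
  have hQas_int : Integrable (fun ω => Q t ω * (a t ω - s t ω)) μ :=
    hindQ.integrable_mul (hQ_int t) (ha_int.sub hs_int)
  have hZs_int : Integrable (fun ω => Z t ω * (ε - s t ω)) μ :=
    hindZ.integrable_mul (hZ_int t) ((integrable_const ε).sub hs_int)
  have hmin_int : Integrable (fun ω => xmax * min (V * γ t ω - (Q t ω + Z t ω)) 0) μ :=
    (((hγ_int.const_mul V).sub ((hQ_int t).add (hZ_int t))).inf (integrable_const 0)).const_mul xmax
  have hEQ : ∫ ω, Q t ω * (a t ω - s t ω) ∂μ =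
      (∫ ω, Q t ω ∂μ) * (∫ ω, a 0 ω ∂μ - ∫ ω, s 0 ω ∂μ) := by
    rw [hindQ.integral_fun_mul_eq_mul_integral (hQ_meas t).aestronglyMeasurable
      ((ha_meas t).sub (hs_meas t)).aestronglyMeasurable, integral_sub ha_int hs_int, hEs, hEa]
  have hEZ : ∫ ω, Z t ω * (ε - s t ω) ∂μ = (∫ ω, Z t ω ∂μ) * (ε - ∫ ω, s 0 ω ∂μ) := by
    rw [hindZ.integral_fun_mul_eq_mul_integral (hZ_meas t).aestronglyMeasurable
      (measurable_const.sub (hs_meas t)).aestronglyMeasurable,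
      integral_sub (integrable_const ε) hs_int, hEs]
    simp
  have hEmin : ∫ ω, xmax * min (V * γ t ω - (Q t ω + Z t ω)) 0 ∂μ ≤
      V * c - (∫ ω, Q t ω ∂μ + ∫ ω, Z t ω ∂μ) * m := by
    have hF : Measurable fun p : ℝ × ℝ => xmax * min (V * p.1 - p.2) 0 := by fun_prop
    have hQZm : Integrable (fun ω => (Q t ω + Z t ω) * m) μ :=
      ((hQ_int t).add (hZ_int t)).mul_const m
    refine (integral_le_of_indepFun (Y := fun ω => Q t ω + Z t ω) (hγ_meas t)
      ((hQ_meas t).add (hZ_meas t)) hindγ hF hmin_int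
      (G := fun y => V * c - y * m) (by fun_prop)
      ((integrable_const (V * c)).sub hQZm) fun y => ?_).trans_eq ?_
    · have hFy : Measurable fun g : ℝ => xmax * min (V * g - y) 0 := by fun_prop
      exact (hγ_id.comp hFy).integral_eq.trans_le (hcm y)
    · rw [integral_sub (integrable_const (V * c)) hQZm, integral_mul_const m,
        integral_add (hQ_int t) (hZ_int t)]
      simp
  have hint1 : Integrable (fun ω => Q t ω ^ 2 + Z t ω ^ 2 + 2 * constB smax amax xmax ε) μ :=
    (hL_int t).add (integrable_const _)
  have hint2 : Integrable (fun ω => Q t ω ^ 2 + Z t ω ^ 2 + 2 * constB smax amax xmax ε +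
      2 * (Q t ω * (a t ω - s t ω))) μ := hint1.add (hQas_int.const_mul 2)
  have hint3 : Integrable (fun ω => Q t ω ^ 2 + Z t ω ^ 2 + 2 * constB smax amax xmax ε +
      2 * (Q t ω * (a t ω - s t ω)) + 2 * (Z t ω * (ε - s t ω))) μ :=
    hint2.add (hZs_int.const_mul 2)
  have hdrift := integral_mono ((hL_int (t + 1)).add (hγX_int.const_mul (2 * V)))
    (hint3.add (hmin_int.const_mul 2))
    fun ω => drift_le (V := V) (γ := path γ ω) hxmax hε (fun t => hs t ω) (fun t => ha t ω) t
  simp only [Pi.add_apply] at hdrift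
  rw [integral_add (hL_int (t + 1)) (hγX_int.const_mul (2 * V)),
    integral_add hint3 (hmin_int.const_mul 2), integral_add hint2 (hZs_int.const_mul 2),
    integral_add hint1 (hQas_int.const_mul 2), integral_add (hL_int t) (integrable_const _),
    integral_const, probReal_univ, one_smul, integral_const_mul, integral_const_mul,
    integral_const_mul, integral_const_mul, hEQ, hEZ] at hdrift
  have hEQb := integral_mem_Icc (μ := μ) (hQ_meas t) (hQ t)
  have hEZb := integral_mem_Icc (μ := μ) (hZ_meas t) (hZ t)
  have h1 := mul_le_mul_of_nonneg_left hm hEQb.1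
  have h2 := mul_le_mul_of_nonneg_left hmε hEZb.1
  have h3 := mul_le_mul_of_nonneg_left (add_le_add hEQb.2 hEZb.2) hδ
  change ∫ ω, (Q (t + 1) ω ^ 2 + Z (t + 1) ω ^ 2) ∂μ + 2 * V * ∫ ω, γ t ω * X ω ∂μ ≤
    ∫ ω, (Q t ω ^ 2 + Z t ω ^ 2) ∂μ + _ + _ + _
  linarith

/-- The threshold rule costs at most `constB / V` more than any feasible policy. -/
theorem timeAvg_algX_le_avgCost_add
    (hs_meas : ∀ t, Measurable (s t)) (ha_meas : ∀ t, Measurable (a t))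
    (hγ_meas : ∀ t, Measurable (γ t))
    (hs : ∀ t ω, 0 ≤ s t ω ∧ s t ω ≤ smax) (ha : ∀ t ω, 0 ≤ a t ω ∧ a t ω ≤ amax)
    (hγ : ∀ t ω, 0 ≤ γ t ω ∧ γ t ω ≤ γmax)
    (hε : 0 ≤ ε) (hV : 0 < V) (hax : amax ≤ xmax) (hεx : ε ≤ xmax) (hiid : IsIID μ s a γ)
    (hεm : ε ≤ max (∫ ω, a 0 ω ∂μ) (∫ ω, s 0 ω ∂μ)) {x : ℕ → Ω × unitInterval → ℝ}
    (hfeas : Feasible μ s a xmax x) {t : ℕ} (ht : 0 < t) :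
    timeAvg μ (fun τ ω => γ τ ω * algX V ε xmax (path s ω) (path a ω) (path γ ω) τ) t ≤
      avgCost μ γ x + constB smax amax xmax ε / V := by
  obtain ⟨ω₀⟩ := μ.nonempty_of_neZero
  let L : ℕ → ℝ := fun t => ∫ ω, (algQ V ε xmax (path s ω) (path a ω) (path γ ω) t ^ 2 +
    algZ V ε xmax (path s ω) (path a ω) (path γ ω) t ^ 2) ∂μ
  let C : ℕ → ℝ := fun t =>
    ∫ ω, γ t ω * algX V ε xmax (path s ω) (path a ω) (path γ ω) t ∂μ
  let M : ℝ := (V * γmax + amax) + (V * γmax + ε)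
  have hM : 0 ≤ M := add_nonneg
    (add_nonneg (mul_nonneg hV.le ((hγ 0 ω₀).1.trans (hγ 0 ω₀).2)) ((ha 0 ω₀).1.trans (ha 0 ω₀).2))
    (add_nonneg (mul_nonneg hV.le ((hγ 0 ω₀).1.trans (hγ 0 ω₀).2)) hε)
  have hslot : ∀ δ > 0, ∀ τ, L (τ + 1) - L τ + 2 * V * C τ ≤
      2 * (constB smax amax xmax ε + V * (avgCost μ γ x + δ) + δ * M) := by
    intro δ hδ τ
    obtain ⟨T, hT, hTc, hTm⟩ := hfeas.exists_timeAvg hs_meas ha_meas hγ_meas hs ha hγ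
      (fun t => ((hiid.2 t).comp measurable_fst).integral_eq)
      (fun t => ((hiid.2 t).comp (measurable_fst.comp measurable_snd)).integral_eq)
      (lt_add_of_pos_right _ hδ) hδ
    have hx0 : 0 ≤ timeAvg (μ.prod volume) x T :=
      timeAvg_nonneg T fun τ => integral_nonneg fun p => (hfeas.2.1 τ p).1
    have hmε : ε - ∫ ω, s 0 ω ∂μ ≤ timeAvg (μ.prod volume) x T + δ := by
      rcases le_max_iff.1 hεm with h | h <;> linarith
    have h := expected_drift_le hs_meas ha_meas hγ_meas hs ha hγ hε hV.le hax hεx hiid hδ.le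
      (integral_min_le_timeAvg hfeas.1 hfeas.2.1 hγ_meas hγ
        (fun t => (hiid.2 t).comp (measurable_snd.comp measurable_snd)) hT) hTm hmε τ
    have := mul_le_mul_of_nonneg_left hTc.le hV.le
    change L (τ + 1) + 2 * V * C τ ≤ L τ + _ + _ + 2 * (δ * M) at h
    linarith
  have hslot' : ∀ τ, L (τ + 1) - L τ + 2 * V * C τ ≤
      2 * (constB smax amax xmax ε + V * avgCost μ γ x) := by
    refine fun τ => le_of_forall_pos_le_add fun η hη => ?_
    have hVM : 0 < 2 * (V + M) := by linarith
    have h := hslot (η / (2 * (V + M))) (div_pos hη hVM) τ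
    have : η / (2 * (V + M)) * (2 * (V + M)) = η := div_mul_cancel₀ _ hVM.ne'
    linarith
  have hsum := Finset.sum_le_card_nsmul (Finset.range t) _ _ fun τ _ => hslot' τ
  rw [Finset.sum_add_distrib, Finset.sum_range_sub, ← Finset.mul_sum, Finset.card_range,
    nsmul_eq_mul] at hsum
  have hL0 : L 0 = 0 := by simp [L, algQ, algZ, algState]
  have hLt : 0 ≤ L t := integral_nonneg fun ω => by positivity
  rw [timeAvg_le_iff ht, ← mul_le_mul_iff_right₀ (by linarith : 0 < 2 * V)]
  refine (by linarith : 2 * V * ∑ τ ∈ Finset.range t, C τ ≤ _).trans_eq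
    (b := t * (2 * (constB smax amax xmax ε + V * avgCost μ γ x))) ?_
  field_simp
  ring

end ExpectedDrift

end RenewableEnergy

theorem theorem1 {Ω : Type*} [MeasurableSpace Ω] (μ : Measure Ω) [IsProbabilityMeasure μ]
    (s a γ : ℕ → Ω → ℝ) (smax amax γmax xmax ε V : ℝ)
    (hs_meas : ∀ t, Measurable (s t)) (ha_meas : ∀ t, Measurable (a t))
    (hγ_meas : ∀ t, Measurable (γ t))
    (hs : ∀ t ω, 0 ≤ s t ω ∧ s t ω ≤ smax)
    (ha : ∀ t ω, 0 ≤ a t ω ∧ a t ω ≤ amax)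
    (hγ : ∀ t ω, 0 ≤ γ t ω ∧ γ t ω ≤ γmax)
    (hε : 0 ≤ ε) (hV : 0 < V) (hx : max amax ε ≤ xmax) :
    -- (a) deterministic queue bounds
    (∀ ω t, algQ V ε xmax (path s ω) (path a ω) (path γ ω) t ≤ V * γmax + amax ∧
      algZ V ε xmax (path s ω) (path a ω) (path γ ω) t ≤ V * γmax + ε) ∧
    -- (b) worst case delay
    (0 < ε → ∀ ω, MaxDelay (path s ω) (path a ω)
      (algX V ε xmax (path s ω) (path a ω) (path γ ω))
      ⌈(2 * V * γmax + amax + ε) / ε⌉₊) ∧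
    -- (c) time average cost
    (IsIID μ s a γ → ε ≤ max (∫ ω, a 0 ω ∂μ) (∫ ω, s 0 ω ∂μ) → ∀ t : ℕ, 0 < t →
      timeAvg μ (fun τ ω => γ τ ω * algXt V ε xmax (path s ω) (path a ω) (path γ ω) τ) t ≤
        timeAvg μ (fun τ ω => γ τ ω * algX V ε xmax (path s ω) (path a ω) (path γ ω) τ) t ∧
      timeAvg μ (fun τ ω => γ τ ω * algX V ε xmax (path s ω) (path a ω) (path γ ω) τ) t ≤
        optCost μ s a γ xmax + constB smax amax xmax ε / V) := by
  have hax := (le_max_left amax ε).trans hx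
  have hεx := (le_max_right amax ε).trans hx
  have hX : ∀ t ω, 0 ≤ algX V ε xmax (path s ω) (path a ω) (path γ ω) t ∧
      algX V ε xmax (path s ω) (path a ω) (path γ ω) t ≤ xmax :=
    fun t ω => threshold_mem_Icc (hε.trans hεx) _ _ _
  refine ⟨fun ω t => ⟨?_, ?_⟩, fun hε' ω => ?_, fun hiid hεm t ht => ⟨?_, ?_⟩⟩
  · exact algQ_le hV.le (fun t => (hs t ω).1) (fun t => ha t ω) (fun t => hγ t ω) hax t
  · exact algZ_le hV.le hε (fun t => (hs t ω).1) (fun t => (ha t ω).1) (fun t => hγ t ω) hεx t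
  · exact maxDelay_algX hV.le hε' (fun t => (hs t ω).1) (fun t => ha t ω) (fun t => hγ t ω)
      hax hεx
  · have hY_meas : ∀ t, Measurable fun ω =>
        algState V ε xmax (path s ω) (path a ω) (path γ ω) t := fun t =>
      measurable_algState (fun i _ => hs_meas i) (fun i _ => ha_meas i) fun i _ => hγ_meas i
    have hX_meas : ∀ t, Measurable fun ω =>
        algX V ε xmax (path s ω) (path a ω) (path γ ω) t := fun t =>
      measurable_threshold (hγ_meas t) (hY_meas t).fst (hY_meas t).snd
    refine mul_le_mul_of_nonneg_left (Finset.sum_le_sum fun τ _ => ?_) (by positivity)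
    -- No integrability of the left side is needed, as it is nonnegative.
    refine integral_mono_of_nonneg (ae_of_all _ fun ω => ?_) (integrable_of_mem_Icc (l := 0)
      (u := γmax * xmax) ((hγ_meas τ).mul (hX_meas τ)) fun ω => ⟨?_, ?_⟩) (ae_of_all _ fun ω => ?_)
    · exact mul_nonneg (hγ τ ω).1 (purchased_nonneg (hX τ ω).1)
    · exact mul_nonneg (hγ τ ω).1 (hX τ ω).1
    · exact mul_le_mul (hγ τ ω).2 (hX τ ω).2 (hX τ ω).1 ((hγ τ ω).1.trans (hγ τ ω).2)
    · exact mul_le_mul_of_nonneg_left (purchased_le (hX τ ω).1) (hγ τ ω).1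
  · -- The infimum of the empty set is `0`, so a feasible policy has to be exhibited.
    rw [← sub_le_iff_le_add]
    refine le_csInf ⟨_, _, feasible_const hs_meas ha_meas hs ha hax, rfl⟩ ?_
    rintro _ ⟨x, hfeas, rfl⟩
    rw [sub_le_iff_le_add]
    exact timeAvg_algX_le_avgCost_add hs_meas ha_meas hγ_meas hs ha hγ hε hV hax hεx hiid hεm
      hfeas ht
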